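/- Let $M$ be a smooth manifold of dimension $2n$ with a smooth almost complex structure $J$ ($J^2=-\mathrm{id}$) and a smooth pseudo-Riemannian metric $g$ which is a Norden metric, i.e. $g(JX,JY)=-g(X,Y)$ for all vector fields $X,Y$. Let $\nabla$ be the Levi-Civita connection of $g$, put $F(x,y,z)=g\bigl((\nabla_xJ)y,z\bigr)$, and assume that $(M,J,g)$ is a $\mathcal W_3$-manifold (a quasi-Kähler manifold with Norden metric), i.e. $F(x,y,z)+F(y,z,x)+F(z,x,y)=0$ for all $p\in M$ and $x,y,z\in T_pM$. Let $R(X,Y)Z=\nabla_X\nabla_YZ-\nabla_Y\nabla_XZ-\nabla_{[X,Y]}Z$ and $R(X,Y,Z,U)=g(R(X,Y)Z,U)$. For $p\in M$ and an arbitrary basis $e_1,\dots,e_{2n}$ of $T_pM$, let $(g^{ij})$ be the inverse of the matrix $(g(e_i,e_j))$, and (summing over repeated indices) put $$\rho(y,z)=g^{ij}R(e_i,y,z,e_j),\qquad \rho^*(y,z)=g^{ij}R(e_i,y,z,Je_j),\qquad \|\nabla J\|^2=g^{ij}g^{kl}g\bigl((\nabla_{e_i}J)e_k,(\nabla_{e_j}J)e_l\bigr).$$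 Then: (i) for all $y,z\in T_pM$, $$\rho^*(Jy,z)+\rho^*(y,Jz)+\rho(y,z)-\rho(Jy,Jz)=-g^{ij}\,g\bigl((\nabla_{e_i}J)y+(\nabla_yJ)e_i,\ (\nabla_zJ)e_j+(\nabla_{e_j}J)z\bigr);$$ (ii) $\|\nabla J\|^2=-2\,g^{ij}g^{kl}\,g\bigl((\nabla_{e_i}J)e_k,(\nabla_{e_l}J)e_j\bigr)$. -/

import Mathlib

open Bundle FiberBundle Module
open scoped Manifold ContDiff

namespace Norden

noncomputable section

/-- A smooth pseudo-Riemannian metric (of arbitrary signature) on a smooth manifold modelled on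
`E`: a smooth field of symmetric nondegenerate bilinear forms on the tangent spaces. -/
structure PseudoMetric (E : Type*) [NormedAddCommGroup E] [NormedSpace ℝ E]
    (M : Type*) [TopologicalSpace M] [ChartedSpace E M] [IsManifold 𝓘(ℝ, E) ∞ M] where
  val (p : M) : TangentSpace 𝓘(ℝ, E) p →L[ℝ] TangentSpace 𝓘(ℝ, E) p →L[ℝ] ℝ
  symm (p : M) (x y : TangentSpace 𝓘(ℝ, E) p) : val p x y = val p y x
  nondegenerate (p : M) (x : TangentSpace 𝓘(ℝ, E) p) (hx : ∀ y, val p x y = 0) : x = 0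
  contMDiff : ContMDiff 𝓘(ℝ, E) (𝓘(ℝ, E).prod 𝓘(ℝ, E →L[ℝ] E →L[ℝ] ℝ)) ∞
    (fun p : M ↦ (TotalSpace.mk' (E →L[ℝ] E →L[ℝ] ℝ) p (val p) :
      TotalSpace (E →L[ℝ] E →L[ℝ] ℝ) (fun p : M ↦
        TangentSpace 𝓘(ℝ, E) p →L[ℝ] TangentSpace 𝓘(ℝ, E) p →L[ℝ] ℝ)))

/-- A smooth almost complex structure: a smooth field of endomorphisms `J` of the tangent spaces
with `J² = -1`. -/
structure AlmostComplex (E : Type*) [NormedAddCommGroup E] [NormedSpace ℝ E]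
    (M : Type*) [TopologicalSpace M] [ChartedSpace E M] [IsManifold 𝓘(ℝ, E) ∞ M] where
  val (p : M) : TangentSpace 𝓘(ℝ, E) p →L[ℝ] TangentSpace 𝓘(ℝ, E) p
  sq_eq_neg (p : M) (x : TangentSpace 𝓘(ℝ, E) p) : val p (val p x) = -x
  contMDiff : ContMDiff 𝓘(ℝ, E) (𝓘(ℝ, E).prod 𝓘(ℝ, E →L[ℝ] E)) ∞
    (fun p : M ↦ (TotalSpace.mk' (E →L[ℝ] E) p (val p) :
      TotalSpace (E →L[ℝ] E) (fun p : M ↦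
        TangentSpace 𝓘(ℝ, E) p →L[ℝ] TangentSpace 𝓘(ℝ, E) p)))

variable {E : Type*} [NormedAddCommGroup E] [NormedSpace ℝ E]
  {M : Type*} [TopologicalSpace M] [ChartedSpace E M] [IsManifold 𝓘(ℝ, E) ∞ M]

/-- `g` is a Norden metric for `J`: `g(Jx, Jy) = -g(x, y)`. -/
def IsNorden (J : AlmostComplex E M) (g : PseudoMetric E M) : Prop :=
  ∀ (p : M) (x y : TangentSpace 𝓘(ℝ, E) p), g.val p (J.val p x) (J.val p y) = -g.val p x y

variable (E M) in
/-- Koszul connections on the tangent bundle; `D Y p (X p)` is `(∇_X Y)(p)`. -/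
abbrev Connection := CovariantDerivative 𝓘(ℝ, E) E (TangentSpace 𝓘(ℝ, E) : M → Type _)

/-- `D` is the Levi-Civita connection of `g`: a smooth connection (it sends smooth fields to
smooth fields) which is torsion free and satisfies `X(g(Y, Z)) = g(∇_X Y, Z) + g(Y, ∇_X Z)`. -/
structure IsLeviCivita [FiniteDimensional ℝ E] (g : PseudoMetric E M) (D : Connection E M) :
    Prop where
  smooth : CovariantDerivative.ContMDiffCovariantDerivative D ∞
  torsion_eq_zero : D.torsion = 0
  metric (Y Z : Π p : M, TangentSpace 𝓘(ℝ, E) p) (p : M)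
    (hY : MDiffAt (T% Y) p) (hZ : MDiffAt (T% Z) p) (x : TangentSpace 𝓘(ℝ, E) p) :
    (d% (fun q ↦ g.val q (Y q) (Z q)) p) x
      = g.val p (D Y p x) (Z p) + g.val p (Y p) (D Z p x)

/-- `R(X, Y)Z = ∇_X ∇_Y Z - ∇_Y ∇_X Z - ∇_[X,Y] Z` for vector fields. -/
def curvatureField (D : Connection E M) (X Y Z : Π p : M, TangentSpace 𝓘(ℝ, E) p) (p : M) :
    TangentSpace 𝓘(ℝ, E) p :=
  D (fun q ↦ D Z q (Y q)) p (X p) - D (fun q ↦ D Z q (X q)) p (Y p)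
    - D Z p (VectorField.mlieBracket 𝓘(ℝ, E) X Y p)

/-- The curvature tensor `R(x, y)z` at tangent vectors, computed with vector fields which extend
`x, y, z` and are smooth near `p`. -/
def curvature (D : Connection E M) (p : M) (x y z : TangentSpace 𝓘(ℝ, E) p) :
    TangentSpace 𝓘(ℝ, E) p :=
  curvatureField D (extend E x) (extend E y) (extend E z) p

/-- `R(x, y, z, u) = g(R(x, y)z, u)`. -/
def curvature4 (g : PseudoMetric E M) (D : Connection E M) (p : M)
    (x y z u : TangentSpace 𝓘(ℝ, E) p) : ℝ :=
  g.val p (curvature D p x y z) u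

/-- `(∇_x J) y = ∇_x (J Y) - J (∇_x Y)`, where `Y` extends `y` and is smooth near `p`. -/
def nablaJ (J : AlmostComplex E M) (D : Connection E M) (p : M)
    (x y : TangentSpace 𝓘(ℝ, E) p) : TangentSpace 𝓘(ℝ, E) p :=
  D (fun q ↦ J.val q (extend E y q)) p x - J.val p (D (extend E y) p x)

/-- `F(x, y, z) = g((∇_x J) y, z)`. -/
def fundF (J : AlmostComplex E M) (g : PseudoMetric E M) (D : Connection E M) (p : M)
    (x y z : TangentSpace 𝓘(ℝ, E) p) : ℝ :=
  g.val p (nablaJ J D p x y) z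

/-- The class `W₃` (quasi-Kähler manifolds with Norden metric): the cyclic sum of `F` vanishes. -/
def IsW3 (J : AlmostComplex E M) (g : PseudoMetric E M) (D : Connection E M) : Prop :=
  ∀ (p : M) (x y z : TangentSpace 𝓘(ℝ, E) p),
    fundF J g D p x y z + fundF J g D p y z x + fundF J g D p z x y = 0

section Contractions

variable {p : M} {ι : Type*} [Fintype ι] [DecidableEq ι]

/-- The components `g^{ij}` of the inverse matrix of `(g(e_i, e_j))`. -/
def invGram (g : PseudoMetric E M) (e : Basis ι ℝ (TangentSpace 𝓘(ℝ, E) p)) : Matrix ι ι ℝ :=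
  (Matrix.of fun i j ↦ g.val p (e i) (e j))⁻¹

/-- The Ricci tensor `ρ(y, z) = g^{ij} R(e_i, y, z, e_j)`. -/
def ricci (g : PseudoMetric E M) (D : Connection E M)
    (e : Basis ι ℝ (TangentSpace 𝓘(ℝ, E) p)) (y z : TangentSpace 𝓘(ℝ, E) p) : ℝ :=
  ∑ i, ∑ j, invGram g e i j * curvature4 g D p (e i) y z (e j)

/-- The associated tensor `ρ*(y, z) = g^{ij} R(e_i, y, z, J e_j)`. -/
def ricciStar (J : AlmostComplex E M) (g : PseudoMetric E M) (D : Connection E M)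
    (e : Basis ι ℝ (TangentSpace 𝓘(ℝ, E) p)) (y z : TangentSpace 𝓘(ℝ, E) p) : ℝ :=
  ∑ i, ∑ j, invGram g e i j * curvature4 g D p (e i) y z (J.val p (e j))

/-- The square norm `‖∇J‖² = g^{ij} g^{kl} g((∇_{e_i} J) e_k, (∇_{e_j} J) e_l)`. -/
def sqNormNablaJ (J : AlmostComplex E M) (g : PseudoMetric E M) (D : Connection E M)
    (e : Basis ι ℝ (TangentSpace 𝓘(ℝ, E) p)) : ℝ :=
  ∑ i, ∑ j, ∑ k, ∑ l, invGram g e i j * invGram g e k l *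
    g.val p (nablaJ J D p (e i) (e k)) (nablaJ J D p (e j) (e l))

end Contractions

end

end Norden

/-! ### Smooth vector fields, cut-off extensions and brackets -/

namespace Norden

open Filter Topology VectorField

variable {E : Type*} [NormedAddCommGroup E] [NormedSpace ℝ E]
  {M : Type*} [TopologicalSpace M] [ChartedSpace E M] [IsManifold 𝓘(ℝ, E) ∞ M]

/-! Since `g` is Norden, `J` is self-adjoint, hence so is each `∇_x J`, which also anticommutes with
`J`. Write `A(x,y) = (∇_x J)y + (∇_y J)x`.

Statement (i) rests on `curvature4_almostComplex`: `R(x,Jx,x,Jx) = -g((∇_x J)x, (∇_x J)x)`. It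
follows by differentiating three identities: the cyclic one for `F`, the symmetry of `∇J`, and `J² =
-1`. The Ricci identity turns the antisymmetric part of `∇²J` into curvature. Both sides are quartic
in `x`; polarizing in `x, y, z, u` and contracting over `x, u` turns the curvature terms into twice
the left side of (i), and the metric terms into twice the contraction of `g(A(x,y), A(z,u))`. The
term with `A(x,u)` drops out because `∇_w J` is trace free.

Statement (ii) is algebraic. The cyclic identity reads `g(A(x,u),w) = -F(w,x,u)`, so the square norm
of `A` equals that of `∇J`. Expanding it gives `2‖∇J‖²` plus twice the mixed contraction.

The tensors are defined through extensions smooth only near `p`, so their multilinearity is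
established first, by moving each argument to a slot where only its value at `p` enters. -/

/-- Globally smooth vector fields. -/
def IsSmooth (X : Π p : M, TangentSpace 𝓘(ℝ, E) p) : Prop :=
  ContMDiff 𝓘(ℝ, E) (𝓘(ℝ, E).prod 𝓘(ℝ, E)) ∞ (T% X)

variable {X Y Z W V : Π p : M, TangentSpace 𝓘(ℝ, E) p} {p : M}

theorem IsSmooth.mdiffAt (hX : IsSmooth X) : MDiffAt (T% X) p :=
  (hX p).mdifferentiableAt (by simp)

theorem IsSmooth.sub (hX : IsSmooth X) (hY : IsSmooth Y) : IsSmooth (X - Y) :=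
  ContMDiff.sub_section hX hY

theorem IsSmooth.smul {f : M → ℝ} (hf : ContMDiff 𝓘(ℝ, E) 𝓘(ℝ, ℝ) ∞ f) (hX : IsSmooth X) :
    IsSmooth (f • X) :=
  ContMDiff.smul_section hf hX

theorem IsSmooth.almostComplex (J : AlmostComplex E M) (hX : IsSmooth X) :
    IsSmooth (fun q ↦ J.val q (X q)) :=
  ContMDiff.clm_bundle_apply (b := fun q : M ↦ q) J.contMDiff hX

theorem IsSmooth.metric (g : PseudoMetric E M) (hX : IsSmooth X) (hY : IsSmooth Y) :
    ContMDiff 𝓘(ℝ, E) 𝓘(ℝ, ℝ) ∞ (fun q ↦ g.val q (X q) (Y q)) := by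
  have := ContMDiff.clm_bundle_apply₂ (E₃ := Bundle.Trivial M ℝ) (b := fun q : M ↦ q)
    (F₃ := ℝ) g.contMDiff hX hY
  intro q
  exact (contMDiffAt_totalSpace.1 (this q)).2

theorem connection_congr (D : Connection E M) (hX : MDiffAt (T% X) p) (hY : MDiffAt (T% Y) p)
    (h : X =ᶠ[𝓝 p] Y) : D X p = D Y p :=
  D.isCovariantDerivativeOnUniv.congr_of_eventuallyEq hX hY univ_mem h

theorem connection_sub (D : Connection E M) (hX : IsSmooth X) (hY : IsSmooth Y) :
    D (X - Y) p = D X p - D Y p := by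
  rw [eq_sub_iff_add_eq, ← D.isCovariantDerivativeOnUniv.add (hX.sub hY).mdiffAt hY.mdiffAt]
  simp

theorem connection_neg (D : Connection E M) (hX : IsSmooth X) :
    D (fun q ↦ -X q) p = -D X p := by
  have h := D.isCovariantDerivativeOnUniv.smul_const (-1) (hX.mdiffAt (p := p))
  have e : (fun q ↦ -X q) = (-1 : ℝ) • X := by funext q; simp
  rw [e, h]; simp

variable [FiniteDimensional ℝ E]

/-- Multiplying by a bump function equal to `1` near `p` globalizes the local extension without
changing its germ. -/
theorem exists_isSmooth_eventuallyEq_extend [T2Space M] (x : TangentSpace 𝓘(ℝ, E) p) :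
    ∃ X : Π p : M, TangentSpace 𝓘(ℝ, E) p, IsSmooth X ∧
      X =ᶠ[𝓝 p] (extend (E := fun q : M ↦ TangentSpace 𝓘(ℝ, E) q) E x) := by
  obtain ⟨s, hs, hsm⟩ := exists_contMDiffOn_extend (k := ∞)
    (V := fun q : M ↦ TangentSpace 𝓘(ℝ, E) q) 𝓘(ℝ, E) E x
  have hs' : interior s ∈ 𝓝 p := interior_mem_nhds.2 hs
  obtain ⟨f, hf⟩ := (SmoothBumpFunction.nhds_basis_tsupport (I := 𝓘(ℝ, E)) p).mem_iff.1 hs'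
  refine ⟨(f : M → ℝ) • (extend (E := fun q : M ↦ TangentSpace 𝓘(ℝ, E) q) E x), ?_, ?_⟩
  · exact ContMDiffOn.smul_section_of_tsupport (u := interior s) f.contMDiff.contMDiffOn
      isOpen_interior hf.2 (hsm.mono interior_subset)
  · filter_upwards [f.eventuallyEq_one] with q hq
    rw [Pi.smul_apply', hq, Pi.one_apply, one_smul]

theorem exists_isSmooth_apply [T2Space M] (x : TangentSpace 𝓘(ℝ, E) p) :
    ∃ X : Π p : M, TangentSpace 𝓘(ℝ, E) p, IsSmooth X ∧ X p = x := by
  obtain ⟨X, hX, h⟩ := exists_isSmooth_eventuallyEq_extend x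
  exact ⟨X, hX, h.self_of_nhds.trans (extend_apply_self E x)⟩

variable {g : PseudoMetric E M} {J : AlmostComplex E M} {D : Connection E M}

theorem IsLeviCivita.isSmooth_nabla (hD : IsLeviCivita g D) (hX : IsSmooth X) (hY : IsSmooth Y) :
    IsSmooth (fun q ↦ D Y q (X q)) := by
  have h := hD.smooth.contMDiff.contMDiff (σ := Y) (contMDiffOn_univ.2 hY)
  exact ContMDiff.clm_bundle_apply (b := fun q : M ↦ q) (contMDiffOn_univ.1 h) hX

theorem IsLeviCivita.bracket (hD : IsLeviCivita g D) (hX : IsSmooth X) (hY : IsSmooth Y) :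
    mlieBracket 𝓘(ℝ, E) X Y = (fun q ↦ D Y q (X q)) - (fun q ↦ D X q (Y q)) := by
  have : IsManifold 𝓘(ℝ, E) 2 M := IsManifold.of_le (n := ∞) (inferInstance : ENat.LEInfty 2).out
  have : CompleteSpace E := FiniteDimensional.complete ℝ E
  funext q
  exact ((CovariantDerivative.torsion_eq_zero_iff D).1 hD.torsion_eq_zero hX.mdiffAt hY.mdiffAt).symm

theorem IsLeviCivita.isSmooth_bracket (hD : IsLeviCivita g D) (hX : IsSmooth X)
    (hY : IsSmooth Y) : IsSmooth (mlieBracket 𝓘(ℝ, E) X Y) := by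
  rw [hD.bracket hX hY]
  exact (hD.isSmooth_nabla hX hY).sub (hD.isSmooth_nabla hY hX)

theorem jacobi (hX : IsSmooth X) (hY : IsSmooth Y) (hZ : IsSmooth Z) :
    mlieBracket 𝓘(ℝ, E) X (mlieBracket 𝓘(ℝ, E) Y Z) p =
      mlieBracket 𝓘(ℝ, E) (mlieBracket 𝓘(ℝ, E) X Y) Z p
        + mlieBracket 𝓘(ℝ, E) Y (mlieBracket 𝓘(ℝ, E) X Z) p := by
  have : IsManifold 𝓘(ℝ, E) (minSmoothness ℝ 3) M :=
    IsManifold.of_le (n := ∞) (by simpa using (inferInstance : ENat.LEInfty 3).out)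
  have : CompleteSpace E := FiniteDimensional.complete ℝ E
  have h2 : minSmoothness ℝ 2 ≤ (∞ : WithTop ℕ∞) := by
    simpa using (inferInstance : ENat.LEInfty 2).out
  exact leibniz_identity_mlieBracket_apply ((hX p).of_le h2) ((hY p).of_le h2) ((hZ p).of_le h2)

end Norden

/-! ### Symmetries of the Riemann curvature -/

namespace Norden

open Filter Topology VectorField

variable {E : Type*} [NormedAddCommGroup E] [NormedSpace ℝ E]
  {M : Type*} [TopologicalSpace M] [ChartedSpace E M] [IsManifold 𝓘(ℝ, E) ∞ M]
variable {X Y Z W V : Π p : M, TangentSpace 𝓘(ℝ, E) p} {p : M}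
variable [FiniteDimensional ℝ E]
variable {g : PseudoMetric E M} {J : AlmostComplex E M} {D : Connection E M}

/-- The derivative of a function along a vector field. -/
noncomputable def dirDeriv (X : Π p : M, TangentSpace 𝓘(ℝ, E) p) (f : M → ℝ) (q : M) : ℝ :=
  (d% f q) (X q)

theorem IsLeviCivita.dirDeriv_metric (hD : IsLeviCivita g D) (hY : IsSmooth Y) (hZ : IsSmooth Z) :
    dirDeriv X (fun q ↦ g.val q (Y q) (Z q)) =
      fun q ↦ g.val q (D Y q (X q)) (Z q) + g.val q (Y q) (D Z q (X q)) := by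
  funext q
  exact hD.metric Y Z q hY.mdiffAt hZ.mdiffAt (X q)

omit [FiniteDimensional ℝ E] [IsManifold 𝓘(ℝ, E) ∞ M] in
theorem dirDeriv_add {f h : M → ℝ} (hf : ContMDiff 𝓘(ℝ, E) 𝓘(ℝ, ℝ) ∞ f)
    (hh : ContMDiff 𝓘(ℝ, E) 𝓘(ℝ, ℝ) ∞ h) :
    dirDeriv X (fun q ↦ f q + h q) p = dirDeriv X f p + dirDeriv X h p := by
  have := mvfderiv_fun_add ((hf p).mdifferentiableAt (by simp)) ((hh p).mdifferentiableAt (by simp))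
  simp [dirDeriv, this]

theorem bracket_smul_right {f : M → ℝ} (hf : ContMDiff 𝓘(ℝ, E) 𝓘(ℝ, ℝ) ∞ f) (hZ : IsSmooth Z) :
    mlieBracket 𝓘(ℝ, E) X (f • Z) = dirDeriv X f • Z + f • mlieBracket 𝓘(ℝ, E) X Z := by
  have : IsManifold 𝓘(ℝ, E) 2 M :=
    IsManifold.of_le (n := ∞) (inferInstance : ENat.LEInfty 2).out
  have : CompleteSpace E := FiniteDimensional.complete ℝ E
  funext q
  exact mlieBracket_smul_right ((hf q).mdifferentiableAt (by simp)) hZ.mdiffAt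

/-- `[X, Y] f = X (Y f) - Y (X f)`. -/
theorem IsLeviCivita.dirDeriv_bracket [T2Space M] (hD : IsLeviCivita g D) {f : M → ℝ}
    (hf : ContMDiff 𝓘(ℝ, E) 𝓘(ℝ, ℝ) ∞ f) (hX : IsSmooth X) (hY : IsSmooth Y)
    (hXf : ContMDiff 𝓘(ℝ, E) 𝓘(ℝ, ℝ) ∞ (dirDeriv X f))
    (hYf : ContMDiff 𝓘(ℝ, E) 𝓘(ℝ, ℝ) ∞ (dirDeriv Y f)) :
    dirDeriv (mlieBracket 𝓘(ℝ, E) X Y) f p =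
      dirDeriv X (dirDeriv Y f) p - dirDeriv Y (dirDeriv X f) p := by
  -- Compare the Jacobi identity for `X, Y, f • Z` with `f` times the one for `X, Y, Z`: what
  -- remains is this multiple of `Z p`.
  have key (Z : Π p : M, TangentSpace 𝓘(ℝ, E) p) (hZ : IsSmooth Z) :
      (dirDeriv X (dirDeriv Y f) p - dirDeriv Y (dirDeriv X f) p
        - dirDeriv (mlieBracket 𝓘(ℝ, E) X Y) f p) • Z p = 0 := by
    have : IsManifold 𝓘(ℝ, E) 2 M :=
      IsManifold.of_le (n := ∞) (inferInstance : ENat.LEInfty 2).out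
    have : CompleteSpace E := FiniteDimensional.complete ℝ E
    have h1 := jacobi (p := p) hX hY (hZ.smul hf)
    have h2 := jacobi (p := p) hX hY hZ
    have hXZ := hD.isSmooth_bracket hX hZ
    have hYZ := hD.isSmooth_bracket hY hZ
    rw [bracket_smul_right hf hZ, bracket_smul_right hf hZ, bracket_smul_right hf hZ,
      mlieBracket_add_right (hZ.smul hYf).mdiffAt (hYZ.smul hf).mdiffAt,
      mlieBracket_add_right (hZ.smul hXf).mdiffAt (hXZ.smul hf).mdiffAt,
      bracket_smul_right hf hXZ, bracket_smul_right hf hYZ, bracket_smul_right hXf hZ,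
      bracket_smul_right hYf hZ] at h1
    simp only [Pi.add_apply, Pi.smul_apply', h2, smul_add] at h1
    rw [sub_smul, sub_smul, sub_sub, sub_eq_zero, ← sub_eq_zero]
    rw [← sub_eq_zero] at h1
    rw [← h1]
    abel
  by_cases h : ∃ z : TangentSpace 𝓘(ℝ, E) p, z ≠ 0
  · obtain ⟨z, hz⟩ := h
    obtain ⟨Z, hZ, rfl⟩ := exists_isSmooth_apply z
    have := (smul_eq_zero.1 (key Z hZ)).resolve_right hz
    linarith
  · push Not at h
    simp [dirDeriv, h]

/-- The curvature operator is skew with respect to the metric. -/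
theorem IsLeviCivita.curvatureField_skew [T2Space M] (hD : IsLeviCivita g D) (hX : IsSmooth X)
    (hY : IsSmooth Y) (hZ : IsSmooth Z) (hW : IsSmooth W) :
    g.val p (curvatureField D X Y Z p) (W p) = -g.val p (Z p) (curvatureField D X Y W p) := by
  have dd {X Y : Π p : M, TangentSpace 𝓘(ℝ, E) p} (hX : IsSmooth X) (hY : IsSmooth Y) :
      ContMDiff 𝓘(ℝ, E) 𝓘(ℝ, ℝ) ∞ (dirDeriv X (fun q ↦ g.val q (Z q) (W q))) ∧
      dirDeriv Y (dirDeriv X (fun q ↦ g.val q (Z q) (W q))) p =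
        g.val p (D (fun q ↦ D Z q (X q)) p (Y p)) (W p) + g.val p (D Z p (X p)) (D W p (Y p))
        + (g.val p (D Z p (Y p)) (D W p (X p)) + g.val p (Z p) (D (fun q ↦ D W q (X q)) p (Y p))) := by
    have hXZ := hD.isSmooth_nabla hX hZ
    have hXW := hD.isSmooth_nabla hX hW
    have h1 := hXZ.metric g hW
    have h2 := hZ.metric g hXW
    rw [hD.dirDeriv_metric hZ hW]
    refine ⟨h1.add h2, ?_⟩
    rw [dirDeriv_add h1 h2, hD.dirDeriv_metric hXZ hW, hD.dirDeriv_metric hZ hXW]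
  -- In the commutator of second derivatives of `g(Z, W)`, the products of first derivatives are
  -- symmetric in `X, Y` and cancel.
  have h := hD.dirDeriv_bracket (p := p) (hZ.metric g hW) hX hY (dd hX hX).1 (dd hY hX).1
  rw [(dd hX hY).2, (dd hY hX).2, hD.dirDeriv_metric hZ hW] at h
  simp only [curvatureField, map_sub, sub_apply]
  linarith

omit [FiniteDimensional ℝ E] in
theorem curvatureField_antisymm (D : Connection E M) :
    curvatureField D X Y Z p = -curvatureField D Y X Z p := by
  simp only [curvatureField]
  rw [mlieBracket_swap_apply (V := X), map_neg]
  abel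

/-- Without torsion, each double bracket unfolds into second covariant derivatives, and the Jacobi
identity regroups into the cyclic sum. -/
theorem IsLeviCivita.bianchi (hD : IsLeviCivita g D) (hX : IsSmooth X) (hY : IsSmooth Y)
    (hZ : IsSmooth Z) :
    curvatureField D X Y Z p + curvatureField D Y Z X p + curvatureField D Z X Y p = 0 := by
  have e (X Y Z : Π p : M, TangentSpace 𝓘(ℝ, E) p) (hX : IsSmooth X) (hY : IsSmooth Y)
      (hZ : IsSmooth Z) : D (fun q ↦ D Z q (Y q)) p (X p) - D (fun q ↦ D Y q (Z q)) p (X p)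
        - D X p (mlieBracket 𝓘(ℝ, E) Y Z p)
        = mlieBracket 𝓘(ℝ, E) X (mlieBracket 𝓘(ℝ, E) Y Z) p := by
    rw [hD.bracket hX (hD.isSmooth_bracket hY hZ), Pi.sub_apply, hD.bracket hY hZ,
      connection_sub D (hD.isSmooth_nabla hY hZ) (hD.isSmooth_nabla hZ hY)]
    rfl
  have h1 := e X Y Z hX hY hZ
  have h2 := e Y Z X hY hZ hX
  have h3 := e Z X Y hZ hX hY
  have hj := jacobi (p := p) hX hY hZ
  have s1 : mlieBracket 𝓘(ℝ, E) (mlieBracket 𝓘(ℝ, E) X Y) Z p =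
    - mlieBracket 𝓘(ℝ, E) Z (mlieBracket 𝓘(ℝ, E) X Y) p := mlieBracket_swap_apply
  have s2 : mlieBracket 𝓘(ℝ, E) Y (mlieBracket 𝓘(ℝ, E) X Z) p =
      - mlieBracket 𝓘(ℝ, E) Y (mlieBracket 𝓘(ℝ, E) Z X) p := by
    have : CompleteSpace E := FiniteDimensional.complete ℝ E
    have : IsManifold 𝓘(ℝ, E) 2 M :=
      IsManifold.of_le (n := ∞) (inferInstance : ENat.LEInfty 2).out
    rw [mlieBracket_swap (V := X), ← neg_one_smul ℝ,
      mlieBracket_const_smul_right (hD.isSmooth_bracket hZ hX).mdiffAt, neg_one_smul]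
  rw [s1, s2, ← h1, ← h2, ← h3] at hj
  simp only [curvatureField]
  rw [← sub_eq_zero] at hj
  rw [← hj]
  abel

/-- The pair symmetry of the curvature tensor. -/
theorem IsLeviCivita.curvatureField_pair [T2Space M] (hD : IsLeviCivita g D) (hX : IsSmooth X)
    (hY : IsSmooth Y) (hZ : IsSmooth Z) (hW : IsSmooth W) :
    g.val p (curvatureField D X Y Z p) (W p) = g.val p (curvatureField D Z W X p) (Y p) := by
  have sk (X Y Z W : Π p : M, TangentSpace 𝓘(ℝ, E) p) (hX : IsSmooth X) (hY : IsSmooth Y)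
      (hZ : IsSmooth Z) (hW : IsSmooth W) :
      g.val p (curvatureField D X Y Z p) (W p) = -g.val p (curvatureField D X Y W p) (Z p) := by
    rw [hD.curvatureField_skew hX hY hZ hW, g.symm]
  have an (X Y Z W : Π p : M, TangentSpace 𝓘(ℝ, E) p) :
      g.val p (curvatureField D X Y Z p) (W p) = -g.val p (curvatureField D Y X Z p) (W p) := by
    rw [curvatureField_antisymm]; simp
  have bi (X Y Z W : Π p : M, TangentSpace 𝓘(ℝ, E) p) (hX : IsSmooth X) (hY : IsSmooth Y)
      (hZ : IsSmooth Z) : g.val p (curvatureField D X Y Z p) (W p)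
        + g.val p (curvatureField D Y Z X p) (W p) + g.val p (curvatureField D Z X Y p) (W p)
        = 0 := by
    have := congrArg (fun v ↦ g.val p v (W p)) (hD.bianchi (p := p) hX hY hZ)
    simpa using this
  -- The classical octahedron argument: four Bianchi identities combined through the two skew
  -- symmetries.
  linarith [bi X Y Z W hX hY hZ, bi Y Z W X hY hZ hW, bi Z W X Y hZ hW hX, bi W X Y Z hW hX hY,
    sk X Y Z W hX hY hZ hW, sk Y Z X W hY hZ hX hW, sk Z X Y W hZ hX hY hW,
    sk Z W Y X hZ hW hY hX, sk W Y Z X hW hY hZ hX, sk W X Z Y hW hX hZ hY,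
    sk X Z W Y hX hZ hW hY, sk X Y W Z hX hY hW hZ, sk Y W X Z hY hW hX hZ,
    an X Z Y W, an X Z W Y, an W Y X Z, an W Y Z X, an X Y Z W, an Z W X Y, an Y Z X W, an Y Z W X,
    an W X Y Z, an W X Z Y, an X Y W Z, an Z W Y X]

end Norden

/-! ### Pointwise character and multilinearity of the curvature -/

namespace Norden

open Filter Topology VectorField

variable {E : Type*} [NormedAddCommGroup E] [NormedSpace ℝ E]
  {M : Type*} [TopologicalSpace M] [ChartedSpace E M] [IsManifold 𝓘(ℝ, E) ∞ M]
variable {X Y Z W V : Π p : M, TangentSpace 𝓘(ℝ, E) p} {p : M}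
variable [FiniteDimensional ℝ E]
variable {g : PseudoMetric E M} {J : AlmostComplex E M} {D : Connection E M}

section Locality

variable {X' Y' Z' : Π p : M, TangentSpace 𝓘(ℝ, E) p}

omit [FiniteDimensional ℝ E] in
theorem mdiffAt_congr (hX : MDiffAt (T% X) p) (h : X =ᶠ[𝓝 p] X') : MDiffAt (T% X') p := by
  refine hX.congr_of_eventuallyEq ?_
  filter_upwards [h] with q hq
  rw [hq]

omit [FiniteDimensional ℝ E] in
theorem connection_eventuallyEq (D : Connection E M) (hX : IsSmooth X) (hY : Y =ᶠ[𝓝 p] Y')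
    (h : X =ᶠ[𝓝 p] X') : (fun q ↦ D X q (Y q)) =ᶠ[𝓝 p] (fun q ↦ D X' q (Y' q)) := by
  filter_upwards [eventually_eventually_nhds.2 h, hY] with q hq hYq
  rw [connection_congr D hX.mdiffAt (mdiffAt_congr hX.mdiffAt hq) hq, hYq]

theorem IsLeviCivita.curvatureField_congr (hD : IsLeviCivita g D) (hX : IsSmooth X)
    (hY : IsSmooth Y) (hZ : IsSmooth Z) (hX' : X =ᶠ[𝓝 p] X') (hY' : Y =ᶠ[𝓝 p] Y')
    (hZ' : Z =ᶠ[𝓝 p] Z') : curvatureField D X Y Z p = curvatureField D X' Y' Z' p := by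
  have e1 := connection_eventuallyEq D hZ hY' hZ'
  have e2 := connection_eventuallyEq D hZ hX' hZ'
  have s1 := (hD.isSmooth_nabla hY hZ).mdiffAt (p := p)
  have s2 := (hD.isSmooth_nabla hX hZ).mdiffAt (p := p)
  simp only [curvatureField]
  rw [connection_congr D s1 (mdiffAt_congr s1 e1) e1, connection_congr D s2 (mdiffAt_congr s2 e2) e2,
    connection_congr D hZ.mdiffAt (mdiffAt_congr hZ.mdiffAt hZ') hZ',
    hX'.mlieBracket_vectorField_eq hY', hX'.self_of_nhds, hY'.self_of_nhds]

end Locality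

section Curvature

variable [T2Space M]

/-- The curvature tensor may be computed with any smooth extensions. -/
theorem IsLeviCivita.curvature4_apply (hD : IsLeviCivita g D) (hX : IsSmooth X) (hY : IsSmooth Y)
    (hZ : IsSmooth Z) (hW : IsSmooth W) :
    curvature4 g D p (X p) (Y p) (Z p) (W p) = g.val p (curvatureField D X Y Z p) (W p) := by
  obtain ⟨X', hX', eX⟩ := exists_isSmooth_eventuallyEq_extend (X p)
  obtain ⟨Y', hY', eY⟩ := exists_isSmooth_eventuallyEq_extend (Y p)
  obtain ⟨Z', hZ', eZ⟩ := exists_isSmooth_eventuallyEq_extend (Z p)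
  have vX : X' p = X p := eX.self_of_nhds.trans (extend_apply_self E _)
  have vY : Y' p = Y p := eY.self_of_nhds.trans (extend_apply_self E _)
  have vZ : Z' p = Z p := eZ.self_of_nhds.trans (extend_apply_self E _)
  -- Skewness and pair symmetry bring `Z'`, `Y'`, `X'` in turn to an undifferentiated slot, where
  -- each may be replaced by a field with the same value at `p`.
  rw [curvature4, curvature, ← hD.curvatureField_congr hX' hY' hZ' eX eY eZ,
    hD.curvatureField_skew hX' hY' hZ' hW, vZ, ← hD.curvatureField_skew hX' hY' hZ hW,
    hD.curvatureField_pair hX' hY' hZ hW, vY, hD.curvatureField_skew hZ hW hX' hY, vX,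
    ← hD.curvatureField_skew hZ hW hX hY, ← hD.curvatureField_pair hX hY hZ hW]

theorem IsLeviCivita.curvature4_swap_right (hD : IsLeviCivita g D)
    (x y z u : TangentSpace 𝓘(ℝ, E) p) :
    curvature4 g D p x y z u = -curvature4 g D p x y u z := by
  obtain ⟨X, hX, rfl⟩ := exists_isSmooth_apply x
  obtain ⟨Y, hY, rfl⟩ := exists_isSmooth_apply y
  obtain ⟨Z, hZ, rfl⟩ := exists_isSmooth_apply z
  obtain ⟨W, hW, rfl⟩ := exists_isSmooth_apply u
  rw [hD.curvature4_apply hX hY hZ hW, hD.curvature4_apply hX hY hW hZ,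
    hD.curvatureField_skew hX hY hZ hW, g.symm]

theorem IsLeviCivita.curvature4_pair (hD : IsLeviCivita g D)
    (x y z u : TangentSpace 𝓘(ℝ, E) p) :
    curvature4 g D p x y z u = curvature4 g D p z u x y := by
  obtain ⟨X, hX, rfl⟩ := exists_isSmooth_apply x
  obtain ⟨Y, hY, rfl⟩ := exists_isSmooth_apply y
  obtain ⟨Z, hZ, rfl⟩ := exists_isSmooth_apply z
  obtain ⟨W, hW, rfl⟩ := exists_isSmooth_apply u
  rw [hD.curvature4_apply hX hY hZ hW, hD.curvature4_apply hZ hW hX hY,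
    hD.curvatureField_pair hX hY hZ hW]

theorem IsLeviCivita.curvature4_swap_left (hD : IsLeviCivita g D)
    (x y z u : TangentSpace 𝓘(ℝ, E) p) :
    curvature4 g D p x y z u = -curvature4 g D p y x z u := by
  rw [hD.curvature4_pair, hD.curvature4_swap_right, hD.curvature4_pair]

omit [FiniteDimensional ℝ E] [T2Space M] in
theorem curvature4_add₄ (x y z u v : TangentSpace 𝓘(ℝ, E) p) :
    curvature4 g D p x y z (u + v) = curvature4 g D p x y z u + curvature4 g D p x y z v := by
  simp [curvature4]

omit [FiniteDimensional ℝ E] [T2Space M] in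
theorem curvature4_smul₄ (c : ℝ) (x y z u : TangentSpace 𝓘(ℝ, E) p) :
    curvature4 g D p x y z (c • u) = c * curvature4 g D p x y z u := by
  simp [curvature4]

theorem IsLeviCivita.curvature4_add₃ (hD : IsLeviCivita g D)
    (x y z u v : TangentSpace 𝓘(ℝ, E) p) :
    curvature4 g D p x y (z + v) u = curvature4 g D p x y z u + curvature4 g D p x y v u := by
  simp only [hD.curvature4_swap_right x y _ u, curvature4_add₄, neg_add]

theorem IsLeviCivita.curvature4_smul₃ (hD : IsLeviCivita g D) (c : ℝ)
    (x y z u : TangentSpace 𝓘(ℝ, E) p) :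
    curvature4 g D p x y (c • z) u = c * curvature4 g D p x y z u := by
  simp only [hD.curvature4_swap_right x y _ u, curvature4_smul₄, mul_neg]

theorem IsLeviCivita.curvature4_add₂ (hD : IsLeviCivita g D)
    (x y z u v : TangentSpace 𝓘(ℝ, E) p) :
    curvature4 g D p x (y + v) z u = curvature4 g D p x y z u + curvature4 g D p x v z u := by
  simp only [hD.curvature4_pair x _ z u, curvature4_add₄]

theorem IsLeviCivita.curvature4_smul₂ (hD : IsLeviCivita g D) (c : ℝ)
    (x y z u : TangentSpace 𝓘(ℝ, E) p) :
    curvature4 g D p x (c • y) z u = c * curvature4 g D p x y z u := by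
  simp only [hD.curvature4_pair x _ z u, curvature4_smul₄]

theorem IsLeviCivita.curvature4_add₁ (hD : IsLeviCivita g D)
    (x y z u v : TangentSpace 𝓘(ℝ, E) p) :
    curvature4 g D p (x + v) y z u = curvature4 g D p x y z u + curvature4 g D p v y z u := by
  simp only [hD.curvature4_pair _ y z u, hD.curvature4_add₃]

theorem IsLeviCivita.curvature4_smul₁ (hD : IsLeviCivita g D) (c : ℝ)
    (x y z u : TangentSpace 𝓘(ℝ, E) p) :
    curvature4 g D p (c • x) y z u = c * curvature4 g D p x y z u := by
  simp only [hD.curvature4_pair _ y z u, hD.curvature4_smul₃]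

end Curvature

/-! ### Algebraic properties of `∇J` -/

section NablaJ

omit [FiniteDimensional ℝ E] in
theorem IsNorden.apply_left (hJ : IsNorden J g) (x y : TangentSpace 𝓘(ℝ, E) p) :
    g.val p (J.val p x) y = g.val p x (J.val p y) := by
  have h := hJ p x (J.val p y)
  rw [J.sq_eq_neg, map_neg] at h
  linarith

omit [FiniteDimensional ℝ E] in
theorem PseudoMetric.ext_left (g : PseudoMetric E M) {x y : TangentSpace 𝓘(ℝ, E) p}
    (h : ∀ z, g.val p x z = g.val p y z) : x = y := by
  rw [← sub_eq_zero]
  apply g.nondegenerate p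
  intro z
  simp [h z]

/-- The field `(∇_V J) W`. -/
noncomputable def nablaJField (J : AlmostComplex E M) (D : Connection E M)
    (V W : Π p : M, TangentSpace 𝓘(ℝ, E) p) (q : M) : TangentSpace 𝓘(ℝ, E) q :=
  D (fun q ↦ J.val q (W q)) q (V q) - J.val q (D W q (V q))

theorem IsLeviCivita.isSmooth_nablaJField (hD : IsLeviCivita g D) (hV : IsSmooth V)
    (hW : IsSmooth W) : IsSmooth (nablaJField J D V W) :=
  (hD.isSmooth_nabla hV (hW.almostComplex J)).sub ((hD.isSmooth_nabla hV hW).almostComplex J)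

/-- `∇_V J` is symmetric with respect to the metric. -/
theorem IsLeviCivita.nablaJField_symm (hD : IsLeviCivita g D) (hJ : IsNorden J g)
    (hW : IsSmooth W) (hZ : IsSmooth Z) :
    g.val p (nablaJField J D V W p) (Z p) = g.val p (W p) (nablaJField J D V Z p) := by
  have h1 := congrFun (hD.dirDeriv_metric (X := V) (hW.almostComplex J) hZ) p
  have h2 := congrFun (hD.dirDeriv_metric (X := V) hW (hZ.almostComplex J)) p
  have e : (fun q ↦ g.val q (J.val q (W q)) (Z q)) = fun q ↦ g.val q (W q) (J.val q (Z q)) := by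
    funext q
    exact hJ.apply_left _ _
  rw [e, h2] at h1
  simp only [hJ.apply_left] at h1
  simp only [nablaJField, map_sub, sub_apply, hJ.apply_left]
  linarith

variable [T2Space M]

/-- The tensor `∇J` may be computed with any smooth extension. -/
theorem IsLeviCivita.nablaJ_apply (hD : IsLeviCivita g D) (hJ : IsNorden J g) (hW : IsSmooth W) :
    nablaJ J D p (V p) (W p) = nablaJField J D V W p := by
  obtain ⟨W', hW', eW⟩ := exists_isSmooth_eventuallyEq_extend (W p)
  have vW : W' p = W p := eW.self_of_nhds.trans (extend_apply_self E _)
  have e : nablaJ J D p (V p) (W p) = nablaJField J D V W' p := by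
    have hJW := (hW'.almostComplex J).mdiffAt (p := p)
    have eJ : (fun q ↦ J.val q (W' q)) =ᶠ[𝓝 p] (fun q ↦ J.val q (extend E (W p) q)) := by
      filter_upwards [eW] with q hq
      rw [hq]
    rw [nablaJ, nablaJField, connection_congr D hJW (mdiffAt_congr hJW eJ) eJ,
      connection_congr D hW'.mdiffAt (mdiffAt_congr hW'.mdiffAt eW) eW]
  rw [e]
  refine g.ext_left fun z ↦ ?_
  obtain ⟨Z, hZ, rfl⟩ := exists_isSmooth_apply z
  -- Symmetry puts `W'` in an undifferentiated slot, so only `W' p = W p` counts.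
  rw [hD.nablaJField_symm hJ hW' hZ, vW, ← hD.nablaJField_symm hJ hW hZ]

theorem IsLeviCivita.nablaJ_symm (hD : IsLeviCivita g D) (hJ : IsNorden J g)
    (x y z : TangentSpace 𝓘(ℝ, E) p) :
    g.val p (nablaJ J D p x y) z = g.val p y (nablaJ J D p x z) := by
  obtain ⟨X, hX, rfl⟩ := exists_isSmooth_apply x
  obtain ⟨Y, hY, rfl⟩ := exists_isSmooth_apply y
  obtain ⟨Z, hZ, rfl⟩ := exists_isSmooth_apply z
  rw [hD.nablaJ_apply hJ hY, hD.nablaJ_apply hJ hZ, hD.nablaJField_symm hJ hY hZ]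

omit [FiniteDimensional ℝ E] [T2Space M] in
theorem nablaJ_add_left (x y z : TangentSpace 𝓘(ℝ, E) p) :
    nablaJ J D p (x + y) z = nablaJ J D p x z + nablaJ J D p y z := by
  simp only [nablaJ, map_add]
  abel

/-- Self-adjointness of `∇_x J` makes linearity automatic, whatever extension is used. -/
theorem IsLeviCivita.nablaJ_add_right (hD : IsLeviCivita g D) (hJ : IsNorden J g)
    (x y z : TangentSpace 𝓘(ℝ, E) p) :
    nablaJ J D p x (y + z) = nablaJ J D p x y + nablaJ J D p x z := by
  refine g.ext_left fun u ↦ ?_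
  simp only [hD.nablaJ_symm hJ, map_add, add_apply]

theorem IsLeviCivita.nablaJ_smul_right (hD : IsLeviCivita g D) (hJ : IsNorden J g) (c : ℝ)
    (x y : TangentSpace 𝓘(ℝ, E) p) :
    nablaJ J D p x (c • y) = c • nablaJ J D p x y := by
  refine g.ext_left fun u ↦ ?_
  simp only [hD.nablaJ_symm hJ, map_smul, smul_apply]

-- Covariant derivative of `J² = -1`.
omit [T2Space M] [FiniteDimensional ℝ E] in
theorem nablaJField_almostComplex (hW : IsSmooth W) :
    nablaJField J D V (fun q ↦ J.val q (W q)) p = -J.val p (nablaJField J D V W p) := by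
  have e : (fun q ↦ J.val q (J.val q (W q))) = fun q ↦ -W q := by
    funext q; exact J.sq_eq_neg q _
  simp only [nablaJField]
  rw [e, connection_neg D hW, map_sub, J.sq_eq_neg, neg_apply]
  abel

theorem IsLeviCivita.nablaJ_almostComplex (hD : IsLeviCivita g D) (hJ : IsNorden J g)
    (x y : TangentSpace 𝓘(ℝ, E) p) :
    nablaJ J D p x (J.val p y) = -J.val p (nablaJ J D p x y) := by
  obtain ⟨X, hX, rfl⟩ := exists_isSmooth_apply x
  obtain ⟨Y, hY, rfl⟩ := exists_isSmooth_apply y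
  rw [hD.nablaJ_apply hJ hY, ← nablaJField_almostComplex hY,
    ← hD.nablaJ_apply hJ (hY.almostComplex J)]

end NablaJ

end Norden

/-! ### Second derivative of `J` and the quartic curvature identity -/

namespace Norden

open Filter Topology VectorField

variable {E : Type*} [NormedAddCommGroup E] [NormedSpace ℝ E]
  {M : Type*} [TopologicalSpace M] [ChartedSpace E M] [IsManifold 𝓘(ℝ, E) ∞ M]
variable {U X Y Z W V : Π p : M, TangentSpace 𝓘(ℝ, E) p} {p : M}
variable [FiniteDimensional ℝ E]
variable {g : PseudoMetric E M} {J : AlmostComplex E M} {D : Connection E M}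

/-- The second covariant derivative `(∇²_{U, V} J) W`. -/
noncomputable def nablaSqJ (J : AlmostComplex E M) (D : Connection E M)
    (U V W : Π p : M, TangentSpace 𝓘(ℝ, E) p) (p : M) : TangentSpace 𝓘(ℝ, E) p :=
  D (nablaJField J D V W) p (U p) - nablaJField J D (fun q ↦ D V q (U q)) W p
    - nablaJField J D V (fun q ↦ D W q (U q)) p

/-- The derivative of `F(V, W, Z)` along `U`. -/
theorem IsLeviCivita.dirDeriv_fundF (hD : IsLeviCivita g D) (hV : IsSmooth V) (hW : IsSmooth W)
    (hZ : IsSmooth Z) :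
    dirDeriv U (fun q ↦ g.val q (nablaJField J D V W q) (Z q)) p =
      g.val p (nablaSqJ J D U V W p) (Z p)
      + g.val p (nablaJField J D (fun q ↦ D V q (U q)) W p) (Z p)
      + g.val p (nablaJField J D V (fun q ↦ D W q (U q)) p) (Z p)
      + g.val p (nablaJField J D V W p) (D Z p (U p)) := by
  rw [hD.dirDeriv_metric (hD.isSmooth_nablaJField hV hW) hZ]
  simp only [nablaSqJ, map_sub, sub_apply]
  ring

/-- Differentiate `F(V,W,Z) = F(V,Z,W)` along `U`; the terms where `∇_U` falls on an argument agree
by the same symmetry. -/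
theorem IsLeviCivita.nablaSqJ_symm (hD : IsLeviCivita g D) (hJ : IsNorden J g) (hU : IsSmooth U)
    (hV : IsSmooth V) (hW : IsSmooth W) (hZ : IsSmooth Z) :
    g.val p (nablaSqJ J D U V W p) (Z p) = g.val p (nablaSqJ J D U V Z p) (W p) := by
  have s (V W Z : Π p : M, TangentSpace 𝓘(ℝ, E) p) (hW : IsSmooth W) (hZ : IsSmooth Z) (q : M) :
      g.val q (nablaJField J D V W q) (Z q) = g.val q (nablaJField J D V Z q) (W q) := by
    rw [hD.nablaJField_symm hJ hW hZ, g.symm]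
  have h := hD.dirDeriv_fundF (J := J) (p := p) (U := U) hV hW hZ
  rw [funext (s V W Z hW hZ), hD.dirDeriv_fundF hV hZ hW] at h
  have hUW := hD.isSmooth_nabla hU hW
  have hUZ := hD.isSmooth_nabla hU hZ
  linarith [s (fun q ↦ D V q (U q)) W Z hW hZ p, s V (fun q ↦ D W q (U q)) Z hUW hZ p,
    s V W (fun q ↦ D Z q (U q)) hW hUZ p]

omit [FiniteDimensional ℝ E] in
theorem nablaJField_add (hW : IsSmooth W) (hZ : IsSmooth Z) :
    nablaJField J D V (W + Z) p = nablaJField J D V W p + nablaJField J D V Z p := by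
  have e : (fun q ↦ J.val q ((W + Z) q)) = (fun q ↦ J.val q (W q)) + fun q ↦ J.val q (Z q) := by
    funext q
    simp
  simp only [nablaJField]
  rw [e, D.isCovariantDerivativeOnUniv.add (hW.almostComplex J).mdiffAt
    (hZ.almostComplex J).mdiffAt, D.isCovariantDerivativeOnUniv.add hW.mdiffAt hZ.mdiffAt]
  simp only [map_add, add_apply]
  abel

/-- Second covariant derivative of `J² = -1`; the two products of first derivatives come from the
Leibniz rule. -/
theorem IsLeviCivita.nablaSqJ_almostComplex (hD : IsLeviCivita g D)
    (hU : IsSmooth U) (hV : IsSmooth V) (hW : IsSmooth W) :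
    nablaSqJ J D U V (fun q ↦ J.val q (W q)) p =
      -J.val p (nablaSqJ J D U V W p) - nablaJField J D U (nablaJField J D V W) p
        - nablaJField J D V (nablaJField J D U W) p := by
  have hN := hD.isSmooth_nablaJField (J := J) hV hW
  have hN' := hD.isSmooth_nablaJField (J := J) hU hW
  have hUW := hD.isSmooth_nabla hU hW
  have e1 : nablaJField J D V (fun q ↦ J.val q (W q)) =
      fun q ↦ -J.val q (nablaJField J D V W q) :=
    funext fun q ↦ nablaJField_almostComplex hW
  have e2 : (fun q ↦ D (fun q ↦ J.val q (W q)) q (U q)) =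
      nablaJField J D U W + fun q ↦ J.val q (D W q (U q)) := by
    funext q
    simp [nablaJField]
  have e3 : nablaJField J D V (nablaJField J D U W + fun q ↦ J.val q (D W q (U q))) p =
      nablaJField J D V (nablaJField J D U W) p
        - J.val p (nablaJField J D V (fun q ↦ D W q (U q)) p) := by
    rw [nablaJField_add hN' (hUW.almostComplex J), nablaJField_almostComplex hUW, sub_eq_add_neg]
  simp only [nablaSqJ]
  rw [e1, e2, e3, connection_neg D (hN.almostComplex J), nablaJField_almostComplex hW]
  have e5 : D (fun q ↦ J.val q (nablaJField J D V W q)) p (U p) =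
      nablaJField J D U (nablaJField J D V W) p
        + J.val p (D (nablaJField J D V W) p (U p)) := by
    rw [nablaJField]; abel
  rw [neg_apply, e5]
  simp only [map_sub]
  abel

/-- The Ricci identity for `J`. -/
theorem IsLeviCivita.nablaSqJ_sub (hD : IsLeviCivita g D) (hU : IsSmooth U) (hV : IsSmooth V)
    (hW : IsSmooth W) :
    nablaSqJ J D U V W p - nablaSqJ J D V U W p =
      curvatureField D U V (fun q ↦ J.val q (W q)) p - J.val p (curvatureField D U V W p) := by
  have e (U V : Π p : M, TangentSpace 𝓘(ℝ, E) p) (hU : IsSmooth U) (hV : IsSmooth V) :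
      D (nablaJField J D V W) p (U p) =
        D (fun q ↦ D (fun q ↦ J.val q (W q)) q (V q)) p (U p)
          - nablaJField J D U (fun q ↦ D W q (V q)) p
          - J.val p (D (fun q ↦ D W q (V q)) p (U p)) := by
    have := connection_sub (p := p) D (hD.isSmooth_nabla hV (hW.almostComplex J))
      ((hD.isSmooth_nabla hV hW).almostComplex J)
    have e' : nablaJField J D V W = (fun q ↦ D (fun q ↦ J.val q (W q)) q (V q))
      - fun q ↦ J.val q (D W q (V q)) := rfl
    rw [e', this, sub_apply, nablaJField]
    abel
  have b : mlieBracket 𝓘(ℝ, E) U V p = D V p (U p) - D U p (V p) :=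
    congrFun (hD.bracket hU hV) p
  have n (v : Π q : M, TangentSpace 𝓘(ℝ, E) q) : nablaJField J D v W p =
      D (fun q ↦ J.val q (W q)) p (v p) - J.val p (D W p (v p)) := rfl
  simp only [nablaSqJ, curvatureField, e U V hU hV, e V U hV hU, map_sub, b, n]
  abel

variable [T2Space M]

/-- The derivative along `U` of the cyclic identity for `F`; the terms with `∇_U` of an argument
form cyclic sums that vanish themselves. -/
theorem IsLeviCivita.nablaSqJ_cyclic (hD : IsLeviCivita g D) (hJ : IsNorden J g)
    (hF : IsW3 J g D) (hU : IsSmooth U) (hV : IsSmooth V) (hW : IsSmooth W) (hZ : IsSmooth Z) :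
    g.val p (nablaSqJ J D U V W p) (Z p) + g.val p (nablaSqJ J D U W Z p) (V p)
      + g.val p (nablaSqJ J D U Z V p) (W p) = 0 := by
  have c (V W Z : Π p : M, TangentSpace 𝓘(ℝ, E) p) (hV : IsSmooth V) (hW : IsSmooth W)
      (hZ : IsSmooth Z) (q : M) :
      g.val q (nablaJField J D V W q) (Z q) + g.val q (nablaJField J D W Z q) (V q)
        + g.val q (nablaJField J D Z V q) (W q) = 0 := by
    have := hF q (V q) (W q) (Z q)
    simpa only [fundF, hD.nablaJ_apply hJ hV, hD.nablaJ_apply hJ hW, hD.nablaJ_apply hJ hZ]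
      using this
  have s1 := (hD.isSmooth_nablaJField (J := J) hV hW).metric g hZ
  have s2 := (hD.isSmooth_nablaJField (J := J) hW hZ).metric g hV
  have s3 := (hD.isSmooth_nablaJField (J := J) hZ hV).metric g hW
  have s12 : ContMDiff 𝓘(ℝ, E) 𝓘(ℝ, ℝ) ∞ (fun q ↦ g.val q (nablaJField J D V W q) (Z q)
    + g.val q (nablaJField J D W Z q) (V q)) := s1.add s2
  have h0 : dirDeriv U (fun _ : M ↦ (0 : ℝ)) p = 0 := by
    simp [dirDeriv, mvfderiv, mfderiv_const]
  rw [← funext (c V W Z hV hW hZ), dirDeriv_add s12 s3, dirDeriv_add s1 s2,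
    hD.dirDeriv_fundF hV hW hZ, hD.dirDeriv_fundF hW hZ hV, hD.dirDeriv_fundF hZ hV hW] at h0
  linarith [c (fun q ↦ D V q (U q)) W Z (hD.isSmooth_nabla hU hV) hW hZ p,
    c V (fun q ↦ D W q (U q)) Z hV (hD.isSmooth_nabla hU hW) hZ p,
    c V W (fun q ↦ D Z q (U q)) hV hW (hD.isSmooth_nabla hU hZ) p]

/-- The curvature of the planes `x, Jx` on a quasi-Kähler manifold with Norden metric. -/
theorem IsLeviCivita.curvature4_almostComplex (hD : IsLeviCivita g D) (hJ : IsNorden J g)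
    (hF : IsW3 J g D) (x : TangentSpace 𝓘(ℝ, E) p) :
    curvature4 g D p x (J.val p x) x (J.val p x)
      = -g.val p (nablaJ J D p x x) (nablaJ J D p x x) := by
  obtain ⟨X, hX, rfl⟩ := exists_isSmooth_apply x
  have hY := hX.almostComplex J
  have hN := hD.isSmooth_nablaJField (J := J) hX hX
  -- Put `N = (∇_X J)X`. `c1` gives `g((∇²_{JX,X} J)X, X) = 0`. By `s` and `a`, `g((∇²_{X,X} J)JX,
  -- X) = -g(N,N)`, so `c2` gives `g((∇²_{X,JX} J)X, X) = 2g(N,N)`. By `r` the difference of the two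
  -- mixed terms is `-2R(X,JX,X,JX)`.
  have c1 := hD.nablaSqJ_cyclic (p := p) hJ hF hY hX hX hX
  have c2 := hD.nablaSqJ_cyclic (p := p) hJ hF hX hY hX hX
  have s := hD.nablaSqJ_symm (p := p) hJ hX hX hY hX
  have a := congrArg (fun v ↦ g.val p v (X p)) (hD.nablaSqJ_almostComplex (J := J) (p := p) hX hX hX)
  have r := congrArg (fun v ↦ g.val p v (X p)) (hD.nablaSqJ_sub (J := J) (p := p) hX hY hX)
  have k := hD.curvature4_apply (p := p) hX hY hX hY
  have k' := hD.curvature4_apply (p := p) hX hY hY hX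
  have sw := hD.curvature4_swap_right (X p) (J.val p (X p)) (J.val p (X p)) (X p)
  have n := hD.nablaJField_symm (V := X) (p := p) hJ hN hX
  simp only [map_sub, map_neg, sub_apply, neg_apply, hJ.apply_left] at a r
  rw [hD.nablaJ_apply hJ hX]
  linarith

end Norden

/-! ### Metric contractions, dual frames and polarization -/

namespace Norden

variable {E : Type*} [NormedAddCommGroup E] [NormedSpace ℝ E]
  {M : Type*} [TopologicalSpace M] [ChartedSpace E M] [IsManifold 𝓘(ℝ, E) ∞ M]
variable {p : M}
variable {g : PseudoMetric E M} {J : AlmostComplex E M} {D : Connection E M}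

section Contract

variable {ι : Type*} [Fintype ι] [DecidableEq ι]

/-- The contraction `g^{ij} T(e_i, e_j)`. -/
noncomputable def contract (g : PseudoMetric E M) (e : Basis ι ℝ (TangentSpace 𝓘(ℝ, E) p))
    (T : TangentSpace 𝓘(ℝ, E) p → TangentSpace 𝓘(ℝ, E) p → ℝ) : ℝ :=
  ∑ i, ∑ j, invGram g e i j * T (e i) (e j)

variable (e : Basis ι ℝ (TangentSpace 𝓘(ℝ, E) p))
  {S T : TangentSpace 𝓘(ℝ, E) p → TangentSpace 𝓘(ℝ, E) p → ℝ}

theorem contract_add : contract g e (fun x u ↦ S x u + T x u) = contract g e S + contract g e T := by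
  simp [contract, mul_add, Finset.sum_add_distrib]

theorem contract_neg : contract g e (fun x u ↦ -T x u) = -contract g e T := by
  simp [contract]

theorem contract_zero : contract g e (fun _ _ ↦ 0) = 0 := by
  simp [contract]

theorem invGram_symm (i j : ι) : invGram g e i j = invGram g e j i := by
  have h : (Matrix.of fun i j ↦ g.val p (e i) (e j)).transpose
      = Matrix.of fun i j ↦ g.val p (e i) (e j) := by
    ext i j; exact g.symm p _ _
  have := Matrix.transpose_nonsing_inv (Matrix.of fun i j ↦ g.val p (e i) (e j))
  rw [h] at this
  exact congrFun (congrFun this j) i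

theorem contract_swap : contract g e (fun x u ↦ T u x) = contract g e T := by
  simp only [contract]
  rw [Finset.sum_comm]
  exact Finset.sum_congr rfl fun i _ ↦ Finset.sum_congr rfl fun j _ ↦ by rw [invGram_symm]

theorem contract_comm (T : TangentSpace 𝓘(ℝ, E) p → TangentSpace 𝓘(ℝ, E) p →
      TangentSpace 𝓘(ℝ, E) p → TangentSpace 𝓘(ℝ, E) p → ℝ) :
    contract g e (fun x u ↦ contract g e (fun v w ↦ T x u v w)) =
      contract g e (fun v w ↦ contract g e (fun x u ↦ T x u v w)) := by
  have h (T : ι → ι → ι → ι → ℝ) : ∑ i, ∑ j, ∑ k, ∑ l, T i j k l =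
      ∑ k, ∑ l, ∑ i, ∑ j, T i j k l := by
    have (i : ι) : ∑ j, ∑ k, ∑ l, T i j k l = ∑ k, ∑ l, ∑ j, T i j k l := by
      rw [Finset.sum_comm]
      exact Finset.sum_congr rfl fun k _ ↦ Finset.sum_comm
    simp only [this]
    rw [Finset.sum_comm]
    exact Finset.sum_congr rfl fun k _ ↦ Finset.sum_comm
  simp only [contract, Finset.mul_sum]
  rw [h]
  refine Finset.sum_congr rfl fun k _ ↦ Finset.sum_congr rfl fun l _ ↦
    Finset.sum_congr rfl fun i _ ↦ Finset.sum_congr rfl fun j _ ↦ by ring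

/-- A kernel vector of the Gram matrix gives a combination of the `e j` orthogonal to everything. -/
theorem gram_det_isUnit : IsUnit (Matrix.of fun i j ↦ g.val p (e i) (e j)).det := by
  rw [isUnit_iff_ne_zero]
  intro h
  obtain ⟨v, hv, hv0⟩ := Matrix.exists_mulVec_eq_zero_iff.2 h
  have h0 : ∑ j, v j • e j = 0 := by
    apply g.nondegenerate p
    intro y
    have : g.val p (∑ j, v j • e j) = 0 := by
      apply ContinuousLinearMap.coe_injective
      refine e.ext fun i ↦ ?_
      have := congrFun hv0 i
      simp only [Matrix.mulVec, dotProduct, Matrix.of_apply, Pi.zero_apply] at this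
      refine Eq.trans ?_ this
      simp [g.symm p (e i), mul_comm]
    rw [this]; rfl
  exact hv (funext (Fintype.linearIndependent_iff.1 e.linearIndependent v h0))

/-- The basis dual to `e` with respect to the metric. -/
noncomputable def dualFrame (g : PseudoMetric E M) (e : Basis ι ℝ (TangentSpace 𝓘(ℝ, E) p)) (i : ι) :
    TangentSpace 𝓘(ℝ, E) p :=
  ∑ j, invGram g e i j • e j

theorem dualFrame_apply (i k : ι) :
    g.val p (dualFrame g e i) (e k) = if i = k then 1 else 0 := by
  have h := Matrix.nonsing_inv_mul _ (gram_det_isUnit (g := g) e)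
  have := congrFun (congrFun h i) k
  rw [Matrix.one_apply, Matrix.mul_apply] at this
  rw [← this]
  simp [dualFrame, sum_apply, invGram]

theorem sum_apply_smul_dualFrame (x : TangentSpace 𝓘(ℝ, E) p) :
    ∑ i, g.val p x (e i) • dualFrame g e i = x := by
  refine g.ext_left fun z ↦ ?_
  have : g.val p (∑ i, g.val p x (e i) • dualFrame g e i) = g.val p x := by
    apply ContinuousLinearMap.coe_injective
    refine e.ext fun i ↦ ?_
    simp [dualFrame_apply]
  rw [this]

theorem sum_dualFrame_apply_smul (x : TangentSpace 𝓘(ℝ, E) p) :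
    ∑ i, g.val p x (dualFrame g e i) • e i = x := by
  conv_rhs => rw [← e.sum_repr x]
  refine Finset.sum_congr rfl fun i _ ↦ ?_
  have h : (g.val p (dualFrame g e i)).toLinearMap = e.coord i := by
    refine e.ext fun k ↦ ?_
    simp [dualFrame_apply, Finsupp.single_apply, eq_comm]
  rw [g.symm]
  congr 1
  exact LinearMap.congr_fun h x

theorem contract_eq_sum_dualFrame (T : TangentSpace 𝓘(ℝ, E) p →ₗ[ℝ] TangentSpace 𝓘(ℝ, E) p →ₗ[ℝ] ℝ) :
    contract g e (fun x u ↦ T x u) = ∑ i, T (e i) (dualFrame g e i) := by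
  simp [contract, dualFrame]

/-- A self-adjoint endomorphism may be moved between the contracted arguments. -/
theorem contract_selfAdjoint (L : TangentSpace 𝓘(ℝ, E) p →ₗ[ℝ] TangentSpace 𝓘(ℝ, E) p)
    (hL : ∀ x y, g.val p (L x) y = g.val p x (L y))
    (T : TangentSpace 𝓘(ℝ, E) p →ₗ[ℝ] TangentSpace 𝓘(ℝ, E) p →ₗ[ℝ] ℝ) :
    contract g e (fun x u ↦ T (L x) u) = contract g e (fun x u ↦ T x (L u)) := by
  have h1 := contract_eq_sum_dualFrame (g := g) e (T.comp L)
  have h2 := contract_eq_sum_dualFrame (g := g) e (T.compl₂ L)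
  simp only [LinearMap.comp_apply, LinearMap.compl₂_apply] at h1 h2
  rw [h1, h2]
  -- Expanding `L` of a frame vector on one side, and of a dual vector on the other, produces the
  -- same coefficients `g(L e_i, e^k)`.
  have e1 (i : ι) : T (L (e i)) (dualFrame g e i) =
      ∑ k, g.val p (L (e i)) (dualFrame g e k) * T (e k) (dualFrame g e i) := by
    conv_lhs => rw [← sum_dualFrame_apply_smul (g := g) e (L (e i))]
    simp
  have e2 (k : ι) : T (e k) (L (dualFrame g e k)) =
      ∑ i, g.val p (L (e i)) (dualFrame g e k) * T (e k) (dualFrame g e i) := by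
    conv_lhs => rw [← sum_apply_smul_dualFrame (g := g) e (L (dualFrame g e k))]
    simp [hL, g.symm p (e _)]
  simp only [e1, e2]
  exact Finset.sum_comm

theorem contract_metric_mul (x y : TangentSpace 𝓘(ℝ, E) p) :
    contract g e (fun v w ↦ g.val p x v * g.val p y w) = g.val p x y := by
  have h := contract_eq_sum_dualFrame (g := g) e
    (LinearMap.mk₂ ℝ (fun v w ↦ g.val p x v * g.val p y w) (by intros; simp; ring)
      (by intros; simp; ring) (by intros; simp; ring) (by intros; simp; ring))
  simp only [LinearMap.mk₂_apply] at h
  rw [h]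
  conv_rhs => rw [g.symm, ← sum_dualFrame_apply_smul (g := g) e y]
  simp [sum_apply, g.symm p (e _), mul_comm]

theorem contract_almostComplex (hJ : IsNorden J g)
    (T : TangentSpace 𝓘(ℝ, E) p →ₗ[ℝ] TangentSpace 𝓘(ℝ, E) p →ₗ[ℝ] ℝ) :
    contract g e (fun x u ↦ T (J.val p x) u) = contract g e (fun x u ↦ T x (J.val p u)) :=
  contract_selfAdjoint e (J.val p).toLinearMap hJ.apply_left T

end Contract

/-- The full polarization of a quartic form that vanishes on the diagonal. -/
theorem polarization_quartic {A : Type*} [AddCommGroup A] {G : A → A → A → A → ℝ}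
    (h1 : ∀ a a' b c d, G (a + a') b c d = G a b c d + G a' b c d)
    (h2 : ∀ a b b' c d, G a (b + b') c d = G a b c d + G a b' c d)
    (h3 : ∀ a b c c' d, G a b (c + c') d = G a b c d + G a b c' d)
    (h4 : ∀ a b c d d', G a b c (d + d') = G a b c d + G a b c d')
    (hs : ∀ a b c d, G a b c d = G c d a b) (h0 : ∀ a, G a a a a = 0) (a b c d : A) :
    G a d b c + G d a b c + G a d c b + G d a c b
      + (G a b d c + G b a d c + G a b c d + G b a c d)
      + (G a c d b + G c a d b + G a c b d + G c a b d) = 0 := by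
  have k1 := h0 (a + b + c + d)
  have k2 := h0 (a + b + c)
  have k3 := h0 (a + b + d)
  have k4 := h0 (a + c + d)
  have k5 := h0 (b + c + d)
  have l1 := h0 (a + b)
  have l2 := h0 (a + c)
  have l3 := h0 (a + d)
  have l4 := h0 (b + c)
  have l5 := h0 (b + d)
  have l6 := h0 (c + d)
  simp only [h1, h2, h3, h4, h0] at k1 k2 k3 k4 k5 l1 l2 l3 l4 l5 l6
  -- Inclusion–exclusion over subsets of `{a, b, c, d}` isolates the sum over all 24 permutations;
  -- `hs` identifies them in pairs, whence the factor `1 / 2`.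
  linear_combination (1 / 2) * (k1 - k2 - k3 - k4 - k5 + l1 + l2 + l3 + l4 + l5 + l6)
    + (1 / 2) * (hs a d b c + hs d a b c + hs a d c b + hs d a c b
      + (hs a b d c + hs b a d c + hs a b c d + hs b a c d)
      + (hs a c d b + hs c a d b + hs a c b d + hs c a b d))

end Norden

/-! ### Contracted curvature and the two trace identities -/

namespace Norden

variable {E : Type*} [NormedAddCommGroup E] [NormedSpace ℝ E] [FiniteDimensional ℝ E]
  {M : Type*} [TopologicalSpace M] [T2Space M] [ChartedSpace E M] [IsManifold 𝓘(ℝ, E) ∞ M]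
variable {p : M}
variable {g : PseudoMetric E M} {J : AlmostComplex E M} {D : Connection E M}
variable {ι : Type*} [Fintype ι] [DecidableEq ι] (e : Basis ι ℝ (TangentSpace 𝓘(ℝ, E) p))

section Ricci

theorem IsLeviCivita.ricci_symm (hD : IsLeviCivita g D) (y z : TangentSpace 𝓘(ℝ, E) p) :
    ricci g D e y z = ricci g D e z y := by
  change contract g e (fun x u ↦ curvature4 g D p x y z u) =
    contract g e (fun x u ↦ curvature4 g D p x z y u)
  rw [← contract_swap]
  congr! 3 with x u
  rw [hD.curvature4_pair, hD.curvature4_swap_left, hD.curvature4_swap_right, neg_neg]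

/-- The curvature form `R(x, y, z, u)` as a bilinear form in `x` and `u`. -/
noncomputable def IsLeviCivita.curvatureForm (hD : IsLeviCivita g D)
    (y z : TangentSpace 𝓘(ℝ, E) p) :
    TangentSpace 𝓘(ℝ, E) p →ₗ[ℝ] TangentSpace 𝓘(ℝ, E) p →ₗ[ℝ] ℝ :=
  LinearMap.mk₂ ℝ (fun x u ↦ curvature4 g D p x y z u)
    (fun _ _ _ ↦ hD.curvature4_add₁ _ _ _ _ _) (fun _ _ _ ↦ hD.curvature4_smul₁ _ _ _ _ _)
    (fun _ _ _ ↦ curvature4_add₄ _ _ _ _ _) (fun _ _ _ ↦ curvature4_smul₄ _ _ _ _ _)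

theorem IsLeviCivita.contract_curvature4_almostComplex (hD : IsLeviCivita g D) (hJ : IsNorden J g)
    (y z : TangentSpace 𝓘(ℝ, E) p) :
    contract g e (fun x u ↦ curvature4 g D p (J.val p x) y z u) = ricciStar J g D e y z :=
  contract_almostComplex e hJ (hD.curvatureForm y z)

/-- Moving one `J` across the contraction creates `J² = -1`. -/
theorem IsLeviCivita.contract_curvature4_almostComplex₂ (hD : IsLeviCivita g D)
    (hJ : IsNorden J g) (y z : TangentSpace 𝓘(ℝ, E) p) :
    contract g e (fun x u ↦ curvature4 g D p (J.val p x) y z (J.val p u)) = -ricci g D e y z := by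
  have h := contract_almostComplex e hJ ((hD.curvatureForm y z).compl₂ (J.val p).toLinearMap)
  simp only [LinearMap.compl₂_apply, ContinuousLinearMap.coe_coe, J.sq_eq_neg, map_neg,
    contract_neg] at h
  exact h

theorem IsLeviCivita.ricciStar_symm (hD : IsLeviCivita g D) (hJ : IsNorden J g)
    (y z : TangentSpace 𝓘(ℝ, E) p) : ricciStar J g D e y z = ricciStar J g D e z y := by
  rw [← hD.contract_curvature4_almostComplex e hJ]
  change _ = contract g e (fun x u ↦ curvature4 g D p x z y (J.val p u))
  rw [← contract_swap]
  congr! 3 with x u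
  rw [hD.curvature4_pair, hD.curvature4_swap_left, hD.curvature4_swap_right, neg_neg]

/-- `J` may change slots under the contraction, while `R` is skew in its first two arguments. -/
theorem IsLeviCivita.contract_curvature4_left (hD : IsLeviCivita g D) (hJ : IsNorden J g)
    (y z : TangentSpace 𝓘(ℝ, E) p) :
    contract g e (fun x u ↦ curvature4 g D p x (J.val p u) y z)
      + contract g e (fun x u ↦ curvature4 g D p u (J.val p x) y z) = 0 := by
  have h := contract_almostComplex e hJ (LinearMap.mk₂ ℝ (fun x u ↦ curvature4 g D p x u y z)
    (fun _ _ _ ↦ hD.curvature4_add₁ _ _ _ _ _) (fun _ _ _ ↦ hD.curvature4_smul₁ _ _ _ _ _)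
    (fun _ _ _ ↦ hD.curvature4_add₂ _ _ _ _ _) (fun _ _ _ ↦ hD.curvature4_smul₂ _ _ _ _ _))
  simp only [LinearMap.mk₂_apply] at h
  have h' := contract_swap (g := g) e (T := fun x u ↦ curvature4 g D p x (J.val p u) y z)
  simp only [hD.curvature4_swap_left (J.val p _) _ y z, contract_neg] at h
  linarith

end Ricci

section NablaJ

theorem IsLeviCivita.metric_nablaJ_add_swap (hD : IsLeviCivita g D) (hJ : IsNorden J g)
    (hF : IsW3 J g D) (x u w : TangentSpace 𝓘(ℝ, E) p) :
    g.val p (nablaJ J D p x u + nablaJ J D p u x) w = -g.val p (nablaJ J D p w x) u := by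
  have h := hF p x u w
  simp only [fundF] at h
  rw [map_add, add_apply]
  rw [hD.nablaJ_symm hJ u w x, g.symm p w] at h
  linarith

/-- An endomorphism anticommuting with `J` has trace zero. -/
theorem IsLeviCivita.contract_nablaJ (hD : IsLeviCivita g D) (hJ : IsNorden J g)
    (w : TangentSpace 𝓘(ℝ, E) p) :
    contract g e (fun x u ↦ g.val p (nablaJ J D p w x) u) = 0 := by
  have h := contract_almostComplex e hJ (LinearMap.mk₂ ℝ
    (fun x u ↦ g.val p (nablaJ J D p w x) (J.val p u))
    (fun _ _ _ ↦ by rw [hD.nablaJ_add_right hJ, map_add, add_apply])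
    (fun _ _ _ ↦ by rw [hD.nablaJ_smul_right hJ, map_smul, smul_apply])
    (fun _ _ _ ↦ by rw [map_add, map_add]) (fun _ _ _ ↦ by rw [map_smul, map_smul]))
  simp only [LinearMap.mk₂_apply, hD.nablaJ_almostComplex hJ, J.sq_eq_neg, map_neg, neg_apply,
    hJ p, contract_neg, neg_neg] at h
  linarith

/-- The polarization of `R(x, Jx, x, Jx) = -g((∇_x J) x, (∇_x J) x)`. -/
theorem IsLeviCivita.curvature4_polarized (hD : IsLeviCivita g D) (hJ : IsNorden J g)
    (hF : IsW3 J g D) (x y z u : TangentSpace 𝓘(ℝ, E) p) :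
    let R (a b c d : TangentSpace 𝓘(ℝ, E) p) := curvature4 g D p a (J.val p b) c (J.val p d)
    let A (a b : TangentSpace 𝓘(ℝ, E) p) := nablaJ J D p a b + nablaJ J D p b a
    R x u y z + R u x y z + (R x u z y + R u x z y)
      + (R x y u z + R y x u z + R x y z u + R y x z u)
      + (R x z u y + R z x u y + R x z y u + R z x y u)
      + g.val p (A x u) (A y z) + g.val p (A x y) (A z u) + g.val p (A y u) (A z x) = 0 := by
  have h := polarization_quartic
    (G := fun a b c d ↦ curvature4 g D p a (J.val p b) c (J.val p d)
      + g.val p (nablaJ J D p a b) (nablaJ J D p c d))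
    (fun _ _ _ _ _ ↦ by
      simp only [hD.curvature4_add₁, nablaJ_add_left, map_add, add_apply]; ring)
    (fun _ _ _ _ _ ↦ by
      simp only [map_add, hD.curvature4_add₂, hD.nablaJ_add_right hJ, add_apply]; ring)
    (fun _ _ _ _ _ ↦ by
      simp only [hD.curvature4_add₃, nablaJ_add_left, map_add]; ring)
    (fun _ _ _ _ _ ↦ by
      simp only [map_add, curvature4_add₄, hD.nablaJ_add_right hJ]; ring)
    (fun a b c d ↦ by rw [hD.curvature4_pair, g.symm])
    (fun a ↦ by rw [hD.curvature4_almostComplex hJ hF]; ring) x y z u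
  intro R A
  simp only [R, A, map_add, add_apply]
  linarith [g.symm p (nablaJ J D p y u) (nablaJ J D p z x),
    g.symm p (nablaJ J D p y u) (nablaJ J D p x z),
    g.symm p (nablaJ J D p u y) (nablaJ J D p z x),
    g.symm p (nablaJ J D p u y) (nablaJ J D p x z)]

theorem IsLeviCivita.ricciStar_add_ricci (hD : IsLeviCivita g D) (hJ : IsNorden J g)
    (hF : IsW3 J g D) (y z : TangentSpace 𝓘(ℝ, E) p) :
    ricciStar J g D e (J.val p y) z + ricciStar J g D e y (J.val p z)
        + ricci g D e y z - ricci g D e (J.val p y) (J.val p z) =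
      -contract g e (fun x u ↦ g.val p (nablaJ J D p x y + nablaJ J D p y x)
        (nablaJ J D p z u + nablaJ J D p u z)) := by
  have h := contract_zero (g := g) e
  rw [← funext₂ fun x u ↦ hD.curvature4_polarized hJ hF x y z u] at h
  simp only [contract_add] at h
  have a1 := hD.contract_curvature4_left e hJ y (J.val p z)
  have a2 := hD.contract_curvature4_left e hJ z (J.val p y)
  -- The four surviving types of curvature term. Each occurs once for `(y, z)` and once for `(z,
  -- y)`; by symmetry of `ρ` and `ρ*` they add up to twice the left side. The terms with `x, u` in
  -- the first pair cancel by `a1` and `a2`.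
  have b (y z : TangentSpace 𝓘(ℝ, E) p) :
      contract g e (fun x u ↦ curvature4 g D p x (J.val p y) u (J.val p z))
          = -ricci g D e (J.val p y) (J.val p z) ∧
        contract g e (fun x u ↦ curvature4 g D p y (J.val p x) u (J.val p z))
          = ricciStar J g D e y (J.val p z) ∧
        contract g e (fun x u ↦ curvature4 g D p x (J.val p y) z (J.val p u))
          = ricciStar J g D e (J.val p y) z ∧
        contract g e (fun x u ↦ curvature4 g D p y (J.val p x) z (J.val p u))
          = ricci g D e y z := by
    refine ⟨?_, ?_, rfl, ?_⟩
    · simp only [hD.curvature4_swap_right _ _ _ (J.val p z), contract_neg]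
      rfl
    · rw [← hD.contract_curvature4_almostComplex e hJ]
      congr! 3 with x u
      rw [hD.curvature4_swap_left, hD.curvature4_swap_right, neg_neg]
    · rw [← neg_neg (ricci g D e y z), ← hD.contract_curvature4_almostComplex₂ e hJ, ← contract_neg]
      congr! 3 with x u
      rw [hD.curvature4_swap_left]
  obtain ⟨b1, b2, b3, b4⟩ := b y z
  obtain ⟨c1, c2, c3, c4⟩ := b z y
  have t0 : contract g e (fun x u ↦ g.val p (nablaJ J D p x u + nablaJ J D p u x)
      (nablaJ J D p y z + nablaJ J D p z y)) = 0 := by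
    simp only [hD.metric_nablaJ_add_swap hJ hF, contract_neg, hD.contract_nablaJ e hJ, neg_zero]
  have t1 : contract g e (fun x u ↦ g.val p (nablaJ J D p y u + nablaJ J D p u y)
      (nablaJ J D p z x + nablaJ J D p x z)) =
      contract g e (fun x u ↦ g.val p (nablaJ J D p x y + nablaJ J D p y x)
        (nablaJ J D p z u + nablaJ J D p u z)) := by
    rw [← contract_swap]
    simp only [add_comm]
  rw [t0, t1, b1, b2, b3, b4, c1, c2, c3, c4] at h
  linarith [hD.ricci_symm e y z, hD.ricci_symm e (J.val p y) (J.val p z),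
    hD.ricciStar_symm e hJ y (J.val p z), hD.ricciStar_symm e hJ (J.val p y) z]

theorem IsLeviCivita.sqNorm_eq (hD : IsLeviCivita g D) (hJ : IsNorden J g) (hF : IsW3 J g D) :
    contract g e (fun x u ↦ contract g e fun v w ↦ g.val p (nablaJ J D p x v) (nablaJ J D p u w)) =
      -2 * contract g e (fun x u ↦ contract g e fun v w ↦
        g.val p (nablaJ J D p x v) (nablaJ J D p w u)) := by
  let C (T : TangentSpace 𝓘(ℝ, E) p → TangentSpace 𝓘(ℝ, E) p →
      TangentSpace 𝓘(ℝ, E) p → TangentSpace 𝓘(ℝ, E) p → ℝ) : ℝ :=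
    contract g e (fun x u ↦ contract g e fun v w ↦ T x u v w)
  have hC (T : TangentSpace 𝓘(ℝ, E) p → TangentSpace 𝓘(ℝ, E) p →
      TangentSpace 𝓘(ℝ, E) p → TangentSpace 𝓘(ℝ, E) p → ℝ) :
      C T = C fun x u v w ↦ T v w x u := contract_comm e T
  have key : C (fun x u v w ↦ g.val p (nablaJ J D p x v + nablaJ J D p v x)
      (nablaJ J D p u w + nablaJ J D p w u)) =
      C fun x u v w ↦ g.val p (nablaJ J D p x v) (nablaJ J D p u w) := by
    -- Expand the inner product of the two `A`'s in a frame; by the cyclic identity their components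
    -- are values of `-F`, and the signs cancel.
    have e1 (x u v w : TangentSpace 𝓘(ℝ, E) p) :
        g.val p (nablaJ J D p x v + nablaJ J D p v x) (nablaJ J D p u w + nablaJ J D p w u) =
          contract g e fun m n ↦ g.val p (nablaJ J D p m x) v * g.val p (nablaJ J D p n u) w := by
      rw [← contract_metric_mul e]
      simp only [hD.metric_nablaJ_add_swap hJ hF, neg_mul_neg]
    have e2 (x u : TangentSpace 𝓘(ℝ, E) p) :
        contract g e (fun v w ↦ g.val p (nablaJ J D p x v + nablaJ J D p v x)
          (nablaJ J D p u w + nablaJ J D p w u)) =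
        contract g e fun m n ↦ g.val p (nablaJ J D p m x) (nablaJ J D p n u) := by
      simp only [e1]
      rw [contract_comm]
      simp only [contract_metric_mul]
    simp only [C, e2]
    exact contract_comm e _
  -- Of the four terms, exchanging the contracted pairs identifies the two squares with each other
  -- (`h1`) and the two mixed terms (`h2`).
  simp only [map_add, add_apply, C, contract_add] at key
  have h1 := hC fun x u v w ↦ g.val p (nablaJ J D p x v) (nablaJ J D p u w)
  have h2 := hC fun x u v w ↦ g.val p (nablaJ J D p x v) (nablaJ J D p w u)
  simp only [C] at h1 h2
  linarith

end NablaJ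

end Norden

theorem mainTheorem6 {n : ℕ}
    {E : Type*} [NormedAddCommGroup E] [NormedSpace ℝ E] [FiniteDimensional ℝ E]
    (hE : Module.finrank ℝ E = 2 * n)
    {M : Type*} [TopologicalSpace M] [T2Space M] [ChartedSpace E M] [IsManifold 𝓘(ℝ, E) ∞ M]
    (J : Norden.AlmostComplex E M) (g : Norden.PseudoMetric E M) (hJg : Norden.IsNorden J g)
    (D : Norden.Connection E M) (hD : Norden.IsLeviCivita g D)
    (hW : Norden.IsW3 J g D)
    (p : M) (e : Module.Basis (Fin (2 * n)) ℝ (TangentSpace 𝓘(ℝ, E) p)) :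
    (∀ y z : TangentSpace 𝓘(ℝ, E) p,
      Norden.ricciStar J g D e (J.val p y) z + Norden.ricciStar J g D e y (J.val p z)
          + Norden.ricci g D e y z - Norden.ricci g D e (J.val p y) (J.val p z)
        = -∑ i, ∑ j, Norden.invGram g e i j *
            g.val p (Norden.nablaJ J D p (e i) y + Norden.nablaJ J D p y (e i))
              (Norden.nablaJ J D p z (e j) + Norden.nablaJ J D p (e j) z)) ∧
    Norden.sqNormNablaJ J g D e
      = -2 * ∑ i, ∑ j, ∑ k, ∑ l, Norden.invGram g e i j * Norden.invGram g e k l *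
          g.val p (Norden.nablaJ J D p (e i) (e k)) (Norden.nablaJ J D p (e l) (e j)) := by
  refine ⟨fun y z ↦ hD.ricciStar_add_ricci e hJg hW y z, ?_⟩
  have h := hD.sqNorm_eq e hJg hW
  simp only [Norden.contract, Finset.mul_sum, ← mul_assoc] at h
  simpa only [Norden.sqNormNablaJ, Finset.mul_sum, ← mul_assoc] using h
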